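/- Let $q\ge 2$ be an integer and $\epsilon_1,\epsilon_2\in[0,(q-1)/q]$. Consider the memoryless two-way channel over $\mathbb Z/q\mathbb Z$ given by $Y_{1n}=X_{1n}+X_{2n}+Z_{1n}$ and $Y_{2n}=X_{1n}+X_{2n}+Z_{2n}$ (modulo $q$), where the noise processes $\{Z_{1n}\}$ and $\{Z_{2n}\}$ are memoryless, independent of each other and of the sources, with $\Pr(Z_{in}=0)=1-\epsilon_i$ and $\Pr(Z_{in}=j)=\epsilon_i/(q-1)$ for $j\ne 0$. The memoryless sources $\{U_{1m}\}$ and $\{U_{2m}\}$ are independent of each other and uniformly distributed on $\mathbb Z/q\mathbb Z$; for $q=2$ this includes the uniform binary source pair in which $U_{2}$ is the output of a binary symmetric channel with input $U_{1}$ and crossover probability $\delta$, when its correlation coefficient $\rho=1-2\delta$ is $0$. A code with $K$ source symbols per terminal and $N$ channel uses consists of encoders $X_{in}=f_{in}(U_i^K,Y_i^{n-1})$, $n=1,\dots,N$, which may adapt to the symbols already received, and decoders $\hat U_j^K=g_i(U_i^K,Y_i^N)$, for $i\ne j$ in $\{1,2\}$. Its distortions are $\mathbb E[d(U_i^K,\hat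 U_i^K)]=K^{-1}\sum_{m=1}^K\Pr(U_{im}\neq\hat U_{im})$, $i=1,2$ (Hamming distortion). A pair $(D_1,D_2)$ is achievable at rate $1$ if there are codes, one for each $K$, with $K/N_K\to 1$ and $\limsup_{K\to\infty}\mathbb E[d(U_i^K,\hat U_i^K)]\le D_i$ for $i=1,2$. Then: 1. Every pair $(D_1,D_2)$ that is achievable at rate $1$ satisfies $D_1\ge\epsilon_2$ and $D_2\ge\epsilon_1$. 2. For every $N\ge1$, every code with $K=N$ has distortions at least $\epsilon_2$ (for $U_1^N$) and at least $\epsilon_1$ (for $U_2^N$). 3. For every $N\ge1$, uncoded transmission $X_{in}=U_{in}$ with the symbol-by-symbol decoders $\hat U_{1n}=Y_{2n}-U_{2n}$ and $\hat U_{2n}=Y_{1n}-U_{1n}$ (modulo $q$) has distortions exactly $\epsilon_2$ (for $U_1^N$) and $\epsilon_1$ (for $U_2^N$); by part 2 no other decoder does better. 4. In particular $(\epsilon_2,\epsilon_1)$ is achievable at rate $1$, so it is the smallest achievable pair in both coordinates and scalar coding is optimal. -/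

import Mathlib

open Filter Topology

/-- A two-way joint source-channel code with `K` source symbols per terminal and `N` channel uses.
Terminal `i` computes its `n`-th channel input from its own source block and its own
previously received symbols (adaptive encoding); after `N` uses it estimates the source block of
the other terminal from its own source block and its whole received block. -/
structure TWCode (U₁ U₂ X₁ X₂ Y₁ Y₂ : Type*) (K N : ℕ) where
  f₁ : (n : Fin N) → (Fin K → U₁) → (Fin n → Y₁) → X₁
  f₂ : (n : Fin N) → (Fin K → U₂) → (Fin n → Y₂) → X₂
  g₁ : (Fin K → U₁) → (Fin N → Y₁) → (Fin K → U₂)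
  g₂ : (Fin K → U₂) → (Fin N → Y₂) → (Fin K → U₁)

/-- The symbols of `y` strictly before time `n`. -/
def past {Y : Type*} {N : ℕ} (y : Fin N → Y) (n : Fin N) : Fin n → Y :=
  fun i => y ⟨i, i.isLt.trans n.isLt⟩

/-- The average of the single-letter distortion `d` over a block of length `K`. -/
noncomputable def blockDistortion {U : Type*} {K : ℕ} (d : U → U → ℝ) (u v : Fin K → U) : ℝ :=
  (K : ℝ)⁻¹ * ∑ m, d (u m) (v m)

section System

variable {U₁ U₂ X₁ X₂ Y₁ Y₂ : Type*}

/-- Joint probability of the source blocks and the received blocks when the code `c` is used over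
the memoryless two-way channel `W x₁ x₂ y₁ y₂ = p(y₁, y₂ | x₁, x₂)` with the memoryless joint
source `pS u₁ u₂`. -/
noncomputable def jointProb (pS : U₁ → U₂ → ℝ) (W : X₁ → X₂ → Y₁ → Y₂ → ℝ) {K N : ℕ}
    (c : TWCode U₁ U₂ X₁ X₂ Y₁ Y₂ K N)
    (u₁ : Fin K → U₁) (u₂ : Fin K → U₂) (y₁ : Fin N → Y₁) (y₂ : Fin N → Y₂) : ℝ :=
  (∏ m, pS (u₁ m) (u₂ m)) *
    ∏ n, W (c.f₁ n u₁ (past y₁ n)) (c.f₂ n u₂ (past y₂ n)) (y₁ n) (y₂ n)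

variable [Fintype U₁] [Fintype U₂] [Fintype Y₁] [Fintype Y₂]

/-- Expected distortion of the reconstruction, at terminal 2, of the source of terminal 1. -/
noncomputable def expDistortion₁ (pS : U₁ → U₂ → ℝ) (W : X₁ → X₂ → Y₁ → Y₂ → ℝ)
    (d : U₁ → U₁ → ℝ) {K N : ℕ} (c : TWCode U₁ U₂ X₁ X₂ Y₁ Y₂ K N) : ℝ :=
  ∑ u₁ : Fin K → U₁, ∑ u₂ : Fin K → U₂, ∑ y₁ : Fin N → Y₁, ∑ y₂ : Fin N → Y₂,
    jointProb pS W c u₁ u₂ y₁ y₂ * blockDistortion d u₁ (c.g₂ u₂ y₂)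

/-- Expected distortion of the reconstruction, at terminal 1, of the source of terminal 2. -/
noncomputable def expDistortion₂ (pS : U₁ → U₂ → ℝ) (W : X₁ → X₂ → Y₁ → Y₂ → ℝ)
    (d : U₂ → U₂ → ℝ) {K N : ℕ} (c : TWCode U₁ U₂ X₁ X₂ Y₁ Y₂ K N) : ℝ :=
  ∑ u₁ : Fin K → U₁, ∑ u₂ : Fin K → U₂, ∑ y₁ : Fin N → Y₁, ∑ y₂ : Fin N → Y₂,
    jointProb pS W c u₁ u₂ y₁ y₂ * blockDistortion d u₂ (c.g₁ u₁ y₁)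

/-- The pair `(D₁, D₂)` is achievable at rate `r` (source symbols per channel use): some sequence
of codes, one for each source blocklength `K`, with `K / N K → r`, has limiting expected
distortions at most `D₁` and `D₂`. -/
def Achievable (pS : U₁ → U₂ → ℝ) (W : X₁ → X₂ → Y₁ → Y₂ → ℝ)
    (d₁ : U₁ → U₁ → ℝ) (d₂ : U₂ → U₂ → ℝ) (r D₁ D₂ : ℝ) : Prop :=
  ∃ (N : ℕ → ℕ) (c : ∀ K : ℕ, TWCode U₁ U₂ X₁ X₂ Y₁ Y₂ K (N K)),
    (∀ K, 0 < K → 0 < N K) ∧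
    Tendsto (fun K : ℕ => (K : ℝ) / (N K : ℝ)) atTop (𝓝 r) ∧
    limsup (fun K : ℕ => expDistortion₁ pS W d₁ (c K)) atTop ≤ D₁ ∧
    limsup (fun K : ℕ => expDistortion₂ pS W d₂ (c K)) atTop ≤ D₂

end System

/-- Scalar coding: `N = K`, with symbol-by-symbol encoders `h₁, h₂` and symbol-by-symbol decoders
`g₁, g₂`. -/
def scalarCode {U₁ U₂ X₁ X₂ Y₁ Y₂ : Type*} (h₁ : U₁ → X₁) (h₂ : U₂ → X₂)
    (g₁ : U₁ → Y₁ → U₂) (g₂ : U₂ → Y₂ → U₁) (N : ℕ) : TWCode U₁ U₂ X₁ X₂ Y₁ Y₂ N N where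
  f₁ := fun n u _ => h₁ (u n)
  f₂ := fun n u _ => h₂ (u n)
  g₁ := fun u y n => g₁ (u n) (y n)
  g₂ := fun u y n => g₂ (u n) (y n)

/-- Hamming distortion. -/
def hamming {U : Type*} [DecidableEq U] (u v : U) : ℝ := if u = v then 0 else 1

/-- Law of the `q`-ary noise: `0` has probability `1 - ε` and each other symbol `ε / (q - 1)`. -/
noncomputable def noiseLaw (q : ℕ) (ε : ℝ) (z : ZMod q) : ℝ :=
  if z = 0 then 1 - ε else ε / ((q : ℝ) - 1)

/-- Transition probability of the two-way channel `Y₁ = X₁ + X₂ + Z₁`, `Y₂ = X₁ + X₂ + Z₂` over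
the integers mod `q`, with independent noises `Z₁`, `Z₂` of parameters `ε₁`, `ε₂`. -/
noncomputable def additiveTWC (q : ℕ) (ε₁ ε₂ : ℝ) (x₁ x₂ y₁ y₂ : ZMod q) : ℝ :=
  noiseLaw q ε₁ (y₁ - (x₁ + x₂)) * noiseLaw q ε₂ (y₂ - (x₁ + x₂))

/-- Uncoded transmission over the additive channel: each terminal sends its source symbols as they
are and subtracts its own symbol from what it receives. -/
def uncoded (q N : ℕ) : TWCode (ZMod q) (ZMod q) (ZMod q) (ZMod q) (ZMod q) (ZMod q) N N :=
  scalarCode id id (fun u y => y - u) (fun u y => y - u) N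

/-! Fix `u₂`. The probability `w k` of a noise word of weight `k` is nonincreasing in `k`, because
`ε ≤ (q-1)/q`; its partial sums `F` are therefore concave, and `F b - F a ≤ w a * (b - a)`. Take `a`
to be the weight of the noise at terminal 2 and `b` the number of symbol errors, and sum over `u₁,
y₁, y₂` with the law of the first noise as weight. For `K = N` both sums on the left equal `q ^ N *
∑ z, F (hammingNorm z)` and cancel: for fixed `u₁`, received pairs biject with noise pairs, and for
fixed `y₂`, source blocks biject with error words. The right side then says that the mean number of
errors is at least the mean noise weight `N * ε₂`. Adaptive encoding is harmless, since the noise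
still determines the received words symbol by symbol.

For `K ≠ N`, replacing `b` by `b + (N - K)` (truncated subtraction) compensates for the change of
length, at a cost that vanishes at rate 1. Uncoded transmission has equality because its error word
is the noise itself. The central step is `le_sum_noiseWord_hammingDist`. -/

open Finset in
/-- A concave sequence lies below its tangents. -/
theorem sum_range_sub_le_of_antitone {w : ℕ → ℝ} (hw : Antitone w) (a b : ℕ) :
    ∑ j ∈ range b, w j - ∑ j ∈ range a, w j ≤ w a * ((b : ℝ) - a) := by
  rcases le_total a b with h | h
  · rw [← sum_Ico_eq_sub _ h]
    have := sum_le_card_nsmul (Ico a b) w (w a) fun j hj => hw (mem_Ico.1 hj).1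
    rw [Nat.card_Ico, nsmul_eq_mul, Nat.cast_sub h] at this
    linarith
  · have := card_nsmul_le_sum (Ico b a) w (w a) fun j hj => hw (mem_Ico.1 hj).2.le
    rw [sum_Ico_eq_sub _ h, Nat.card_Ico, nsmul_eq_mul, Nat.cast_sub h] at this
    linarith

/-! ### Weight distributions of words of different lengths. -/

section Weight

variable {G : Type*} [Fintype G] [DecidableEq G] [Zero G]

omit [Fintype G] in
theorem hammingNorm_cons {n : ℕ} (g : G) (z : Fin n → G) :
    hammingNorm (Fin.cons g z : Fin (n + 1) → G) =
      (if g = 0 then 0 else 1) + hammingNorm z := by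
  simp only [hammingNorm, Finset.card_filter, Fin.sum_univ_succ, Fin.cons_zero, Fin.cons_succ]
  congr 1
  split_ifs <;> simp_all

omit [DecidableEq G] [Zero G] in
theorem sum_fin_succ_fun {M : Type*} [AddCommMonoid M] {n : ℕ} (f : (Fin (n + 1) → G) → M) :
    ∑ z, f z = ∑ g : G, ∑ z : Fin n → G, f (Fin.cons g z) := by
  rw [← Fintype.sum_prod_type']
  exact (Equiv.sum_comp (Fin.consEquiv fun _ => G) f).symm

/-- Prepending a letter never lowers the weight, and raises it by at most one; the latter gives the
companion upper bound. -/
theorem card_mul_sum_hammingNorm_le {n : ℕ} {F : ℕ → ℝ} (hF : Monotone F) :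
    (Fintype.card G : ℝ) * ∑ z : Fin n → G, F (hammingNorm z) ≤
      ∑ z : Fin (n + 1) → G, F (hammingNorm z) := by
  rw [sum_fin_succ_fun, ← nsmul_eq_mul, ← Finset.card_univ, ← Finset.sum_const]
  gcongr with g _ z
  exact hF (by rw [hammingNorm_cons]; omega)

theorem sum_hammingNorm_le_card_mul {n : ℕ} {F : ℕ → ℝ} (hF : Monotone F) :
    ∑ z : Fin (n + 1) → G, F (hammingNorm z) ≤
      (Fintype.card G : ℝ) * ∑ z : Fin n → G, F (hammingNorm z + 1) := by
  rw [sum_fin_succ_fun, ← nsmul_eq_mul, ← Finset.card_univ, ← Finset.sum_const]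
  gcongr with g _ z
  exact hF (by rw [hammingNorm_cons]; split_ifs <;> omega)

theorem card_pow_mul_sum_hammingNorm_le {F : ℕ → ℝ} (hF : Monotone F) (n m : ℕ) :
    (Fintype.card G : ℝ) ^ m * ∑ z : Fin n → G, F (hammingNorm z) ≤
      ∑ z : Fin (n + m) → G, F (hammingNorm z) := by
  induction m with
  | zero => simp
  | succ m ih =>
    calc _ = (Fintype.card G : ℝ) *
          ((Fintype.card G : ℝ) ^ m * ∑ z : Fin n → G, F (hammingNorm z)) := by ring
      _ ≤ _ := mul_le_mul_of_nonneg_left ih (Nat.cast_nonneg _)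
      _ ≤ _ := card_mul_sum_hammingNorm_le hF

theorem sum_hammingNorm_le_card_pow_mul {F : ℕ → ℝ} (hF : Monotone F) (n m : ℕ) :
    ∑ z : Fin (n + m) → G, F (hammingNorm z) ≤
      (Fintype.card G : ℝ) ^ m * ∑ z : Fin n → G, F (hammingNorm z + m) := by
  induction m generalizing F with
  | zero => simp
  | succ m ih =>
    have hF' : Monotone fun k => F (k + 1) := fun a b h => hF (Nat.add_le_add_right h 1)
    calc ∑ z : Fin (n + m + 1) → G, F (hammingNorm z)
        ≤ (Fintype.card G : ℝ) * ∑ z : Fin (n + m) → G, F (hammingNorm z + 1) :=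
          sum_hammingNorm_le_card_mul hF
      _ ≤ _ := mul_le_mul_of_nonneg_left (ih hF') (Nat.cast_nonneg _)
      _ = _ := by simp only [pow_succ', mul_assoc, add_assoc]

/-- Comparison of the weight distributions of words of lengths `K` and `N`. -/
theorem card_pow_mul_sum_hammingNorm_compare {F : ℕ → ℝ} (hF : Monotone F) (K N : ℕ) :
    (Fintype.card G : ℝ) ^ K * ∑ z : Fin N → G, F (hammingNorm z) ≤
      (Fintype.card G : ℝ) ^ N * ∑ u : Fin K → G, F (hammingNorm u + (N - K)) := by
  rcases le_total K N with h | h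
  · obtain ⟨m, rfl⟩ := Nat.exists_eq_add_of_le h
    rw [Nat.add_sub_cancel_left, pow_add, mul_assoc]
    exact mul_le_mul_of_nonneg_left (sum_hammingNorm_le_card_pow_mul hF K m) (by positivity)
  · obtain ⟨m, rfl⟩ := Nat.exists_eq_add_of_le h
    rw [Nat.sub_eq_zero_of_le h, pow_add, mul_assoc]
    exact mul_le_mul_of_nonneg_left (card_pow_mul_sum_hammingNorm_le hF N m) (by positivity)

end Weight

/-! ### The `q`-ary noise law and its dependence on weight. -/

section Noise

variable {q : ℕ} [NeZero q]

omit [NeZero q] in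
theorem noiseLaw_nonneg (hq : 2 ≤ q) {ε : ℝ} (h0 : 0 ≤ ε) (h1 : ε ≤ ((q : ℝ) - 1) / q)
    (z : ZMod q) : 0 ≤ noiseLaw q ε z := by
  have hq' : (2 : ℝ) ≤ q := by exact_mod_cast hq
  have : ((q : ℝ) - 1) / q ≤ 1 := by rw [div_le_one (by linarith)]; linarith
  unfold noiseLaw
  split_ifs
  · linarith
  · exact div_nonneg h0 (by linarith)

theorem sum_noiseLaw_mul (ε : ℝ) (a b : ℝ) (hq : 2 ≤ q) :
    ∑ z : ZMod q, noiseLaw q ε z * (if z = 0 then a else b) = (1 - ε) * a + ε * b := by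
  have hq' : (2 : ℝ) ≤ q := by exact_mod_cast hq
  have hne : (q : ℝ) - 1 ≠ 0 := by linarith
  rw [← Finset.add_sum_erase _ _ (Finset.mem_univ (0 : ZMod q))]
  rw [Finset.sum_congr rfl (g := fun _ => ε / ((q : ℝ) - 1) * b)
    fun z hz => by simp [noiseLaw, Finset.ne_of_mem_erase hz]]
  rw [Finset.sum_const, Finset.card_erase_of_mem (Finset.mem_univ _), Finset.card_univ, ZMod.card,
    nsmul_eq_mul, Nat.cast_sub (by omega)]
  simp only [noiseLaw, if_true, Nat.cast_one]
  field_simp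

theorem sum_noiseLaw (hq : 2 ≤ q) (ε : ℝ) : ∑ z : ZMod q, noiseLaw q ε z = 1 := by
  simpa using sum_noiseLaw_mul ε 1 1 hq

theorem sum_prod_noiseLaw (hq : 2 ≤ q) (ε : ℝ) (N : ℕ) :
    ∑ z : Fin N → ZMod q, ∏ i, noiseLaw q ε (z i) = 1 := by
  rw [← Fintype.piFinset_univ, ← Finset.prod_univ_sum]
  simp [sum_noiseLaw hq]

theorem sum_prod_noiseLaw_mul_hammingNorm (hq : 2 ≤ q) (ε : ℝ) (N : ℕ) :
    ∑ z : Fin N → ZMod q, (∏ i, noiseLaw q ε (z i)) * (hammingNorm z : ℝ) = N * ε := by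
  induction N with
  | zero => simp [hammingNorm]
  | succ n ih =>
    rw [sum_fin_succ_fun]
    have h : ∀ g : ZMod q, ∑ z : Fin n → ZMod q,
        (∏ i, noiseLaw q ε ((Fin.cons g z : Fin (n + 1) → ZMod q) i)) *
          (hammingNorm (Fin.cons g z : Fin (n + 1) → ZMod q) : ℝ) =
        noiseLaw q ε g * (if g = 0 then n * ε else n * ε + 1) := by
      intro g
      have : ∀ z : Fin n → ZMod q,
          (∏ i, noiseLaw q ε ((Fin.cons g z : Fin (n + 1) → ZMod q) i)) *
            (hammingNorm (Fin.cons g z : Fin (n + 1) → ZMod q) : ℝ) =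
          noiseLaw q ε g * ((∏ i, noiseLaw q ε (z i)) * (hammingNorm z : ℝ) +
            (if g = 0 then 0 else 1) * ∏ i, noiseLaw q ε (z i)) := by
        intro z
        rw [hammingNorm_cons, Fin.prod_univ_succ]
        push_cast
        simp only [Fin.cons_zero, Fin.cons_succ]
        ring
      rw [Finset.sum_congr rfl fun z _ => this z, ← Finset.mul_sum, Finset.sum_add_distrib, ih,
        ← Finset.mul_sum, sum_prod_noiseLaw hq]
      split_ifs <;> simp
    rw [Finset.sum_congr rfl fun g _ => h g, sum_noiseLaw_mul _ _ _ hq]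
    push_cast
    ring

/-- Probability of a noise word of length `N` and weight `k`. -/
noncomputable def noiseWeightLaw (q N : ℕ) (ε : ℝ) (k : ℕ) : ℝ :=
  (1 - ε) ^ (N - k) * (ε / ((q : ℝ) - 1)) ^ k

omit [NeZero q] in
theorem prod_noiseLaw {N : ℕ} (ε : ℝ) (z : Fin N → ZMod q) :
    ∏ i, noiseLaw q ε (z i) = noiseWeightLaw q N ε (hammingNorm z) := by
  have h := Finset.card_filter_add_card_filter_not (s := (Finset.univ : Finset (Fin N)))
    (fun i => z i = 0)
  rw [Finset.card_univ, Fintype.card_fin] at h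
  simp only [noiseLaw, Finset.prod_ite, Finset.prod_const, noiseWeightLaw, hammingNorm, ne_eq]
  congr 2
  omega

-- The hypothesis `ε ≤ (q-1)/q` is equivalent to `ε/(q-1) ≤ 1-ε`: no nonzero symbol is likelier than
-- zero, so exchanging a zero for a nonzero symbol cannot raise the probability.
omit [NeZero q] in
theorem noiseWeightLaw_nonneg_antitone (hq : 2 ≤ q) {ε : ℝ} (h0 : 0 ≤ ε)
    (h1 : ε ≤ ((q : ℝ) - 1) / q) (N : ℕ) :
    (∀ k, 0 ≤ noiseWeightLaw q N ε k) ∧ Antitone (noiseWeightLaw q N ε) := by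
  have hq' : (2 : ℝ) ≤ q := by exact_mod_cast hq
  rw [le_div_iff₀ (by linarith)] at h1
  have ht0 : 0 ≤ ε / ((q : ℝ) - 1) := div_nonneg h0 (by linarith)
  have ht : ε / ((q : ℝ) - 1) ≤ 1 - ε := by
    rw [div_le_iff₀ (by linarith)]; linarith
  have hs0 : 0 ≤ 1 - ε := ht0.trans ht
  have ht1 : ε / ((q : ℝ) - 1) ≤ 1 := by linarith
  refine ⟨fun k => by unfold noiseWeightLaw; positivity, antitone_nat_of_succ_le fun k => ?_⟩
  unfold noiseWeightLaw
  rcases lt_or_ge k N with h | h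
  · rw [show N - k = N - (k + 1) + 1 by omega, pow_succ, pow_succ (1 - ε), mul_assoc,
      mul_comm _ (ε / _)]
    exact mul_le_mul_of_nonneg_left (mul_le_mul_of_nonneg_right ht (by positivity)) (by positivity)
  -- Beyond weight `N` the first exponent is truncated to zero and the law is a pure power. This
  -- range matters because the shifted error count can exceed `N`.
  · rw [Nat.sub_eq_zero_of_le h, Nat.sub_eq_zero_of_le (by omega)]
    exact mul_le_mul_of_nonneg_left (pow_le_pow_of_le_one ht0 ht1 (Nat.le_succ k)) (by simp)

end Noise

/-! ### Change of variables from received words to noise, and the converse. -/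

section Code

variable {q : ℕ} {K N : ℕ}

/-- The noise word that turns the transmitted sums into the received word `y`. -/
def noiseWord {U₁ U₂ Y₁ Y₂ : Type*} (c : TWCode U₁ U₂ (ZMod q) (ZMod q) Y₁ Y₂ K N)
    (u₁ : Fin K → U₁) (u₂ : Fin K → U₂) (y₁ : Fin N → Y₁) (y₂ : Fin N → Y₂)
    (y : Fin N → ZMod q) (n : Fin N) : ZMod q :=
  y n - (c.f₁ n u₁ (past y₁ n) + c.f₂ n u₂ (past y₂ n))

theorem past_congr {Y : Type*} {y y' : Fin N → Y} {n : Fin N} (h : ∀ i < n, y i = y' i) :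
    past y n = past y' n :=
  funext fun i => h _ (Fin.lt_def.2 i.isLt)

variable (c : TWCode (ZMod q) (ZMod q) (ZMod q) (ZMod q) (ZMod q) (ZMod q) K N)

/-- The system is triangular in time: the inputs at time `n` depend only on earlier received
symbols, so the noise recovers `y₁` by strong induction. -/
theorem noiseWord_injective (u₁ u₂ : Fin K → ZMod q) (y₂ : Fin N → ZMod q) :
    Function.Injective fun y₁ => noiseWord c u₁ u₂ y₁ y₂ y₁ := by
  intro y y' h
  funext n
  induction n using WellFoundedLT.induction with
  | ind n ih =>
    have := congrFun h n
    simpa only [noiseWord, past_congr ih, sub_left_inj] using this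

theorem noiseWord_prod_injective (u₁ u₂ : Fin K → ZMod q) :
    Function.Injective fun y : (Fin N → ZMod q) × (Fin N → ZMod q) =>
      (noiseWord c u₁ u₂ y.1 y.2 y.1, noiseWord c u₁ u₂ y.1 y.2 y.2) := by
  intro y y' h
  rw [Prod.mk.injEq] at h
  have key : ∀ n, y.1 n = y'.1 n ∧ y.2 n = y'.2 n := by
    intro n
    induction n using WellFoundedLT.induction with
    | ind n ih =>
      have h1 := congrFun h.1 n
      have h2 := congrFun h.2 n
      simp only [noiseWord, past_congr fun i hi => (ih i hi).1,
        past_congr fun i hi => (ih i hi).2, sub_left_inj] at h1 h2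
      exact ⟨h1, h2⟩
  exact Prod.ext (funext fun n => (key n).1) (funext fun n => (key n).2)

variable [NeZero q]

theorem sum_prod_noiseLaw_noiseWord (hq : 2 ≤ q) (ε : ℝ) (u₁ u₂ : Fin K → ZMod q)
    (y₂ : Fin N → ZMod q) :
    ∑ y₁, ∏ n, noiseLaw q ε (noiseWord c u₁ u₂ y₁ y₂ y₁ n) = 1 := by
  rw [← sum_prod_noiseLaw hq ε N]
  exact (Finite.injective_iff_bijective.1 (noiseWord_injective c u₁ u₂ y₂)).sum_comp
    fun z => ∏ n, noiseLaw q ε (z n)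

/-- An injective self-map of a finite set is a bijection, so the sum runs over independent noise
pairs and the first noise integrates out. -/
theorem sum_prod_noiseLaw_mul_noiseWord (hq : 2 ≤ q) (ε : ℝ) (u₁ u₂ : Fin K → ZMod q)
    (H : (Fin N → ZMod q) → ℝ) :
    ∑ y₁, ∑ y₂, (∏ n, noiseLaw q ε (noiseWord c u₁ u₂ y₁ y₂ y₁ n)) *
      H (noiseWord c u₁ u₂ y₁ y₂ y₂) = ∑ z, H z := by
  rw [← Fintype.sum_prod_type']
  rw [(Finite.injective_iff_bijective.1 (noiseWord_prod_injective c u₁ u₂)).sum_comp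
    fun z => (∏ n, noiseLaw q ε (z.1 n)) * H z.2]
  rw [Fintype.sum_prod_type]
  dsimp only
  rw [← Fintype.sum_mul_sum, sum_prod_noiseLaw hq, one_mul]

omit [NeZero q] in
theorem jointProb_additiveTWC (ε₁ ε₂ : ℝ) {pS : ZMod q → ZMod q → ℝ}
    (hS : ∀ u v, pS u v = 1 / (q : ℝ) * (1 / (q : ℝ)))
    (u₁ u₂ : Fin K → ZMod q) (y₁ y₂ : Fin N → ZMod q) :
    jointProb pS (additiveTWC q ε₁ ε₂) c u₁ u₂ y₁ y₂ =
      ((q : ℝ) ^ K)⁻¹ * ((q : ℝ) ^ K)⁻¹ *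
        ((∏ n, noiseLaw q ε₁ (noiseWord c u₁ u₂ y₁ y₂ y₁ n)) *
          noiseWeightLaw q N ε₂ (hammingNorm (noiseWord c u₁ u₂ y₁ y₂ y₂))) := by
  simp only [jointProb, additiveTWC, hS, Finset.prod_const, Finset.card_univ, Fintype.card_fin,
    Finset.prod_mul_distrib, ← prod_noiseLaw]
  congr 1
  rw [mul_pow, one_div, inv_pow]

omit [NeZero q] in
theorem blockDistortion_hamming (u v : Fin K → ZMod q) :
    blockDistortion hamming u v = (K : ℝ)⁻¹ * hammingDist u v := by
  simp only [blockDistortion, hamming, hammingDist, Finset.card_filter, Nat.cast_sum]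
  congr 2
  funext m
  split_ifs <;> simp_all

theorem expDistortion₁_eq (ε₁ ε₂ : ℝ) {pS : ZMod q → ZMod q → ℝ}
    (hS : ∀ u v, pS u v = 1 / (q : ℝ) * (1 / (q : ℝ))) :
    expDistortion₁ pS (additiveTWC q ε₁ ε₂) hamming c =
      (K : ℝ)⁻¹ * (((q : ℝ) ^ K)⁻¹ * ((q : ℝ) ^ K)⁻¹ * ∑ u₂, ∑ u₁, ∑ y₁, ∑ y₂,
        (∏ n, noiseLaw q ε₁ (noiseWord c u₁ u₂ y₁ y₂ y₁ n)) *
          (noiseWeightLaw q N ε₂ (hammingNorm (noiseWord c u₁ u₂ y₁ y₂ y₂)) *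
            hammingDist u₁ (c.g₂ u₂ y₂))) := by
  rw [expDistortion₁, Finset.sum_comm]
  simp only [jointProb_additiveTWC c ε₁ ε₂ hS, blockDistortion_hamming, Finset.mul_sum]
  refine Finset.sum_congr rfl fun _ _ => Finset.sum_congr rfl fun _ _ =>
    Finset.sum_congr rfl fun _ _ => Finset.sum_congr rfl fun _ _ => ?_
  ring

/-- Total weight of the noise law at a fixed pair of source blocks. -/
theorem sum_prod_noiseLaw_mul_noiseWeightLaw (hq : 2 ≤ q) (ε₁ ε₂ : ℝ)
    (u₁ u₂ : Fin K → ZMod q) :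
    ∑ y₁, ∑ y₂, (∏ n, noiseLaw q ε₁ (noiseWord c u₁ u₂ y₁ y₂ y₁ n)) *
      noiseWeightLaw q N ε₂ (hammingNorm (noiseWord c u₁ u₂ y₁ y₂ y₂)) = 1 := by
  rw [sum_prod_noiseLaw_mul_noiseWord c hq ε₁ u₁ u₂ fun z => noiseWeightLaw q N ε₂ (hammingNorm z)]
  simp only [← prod_noiseLaw]
  exact sum_prod_noiseLaw hq ε₂ N

theorem sum_prod_noiseLaw_mul_noiseWeightLaw_mul_hammingNorm (hq : 2 ≤ q) (ε₁ ε₂ : ℝ)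
    (u₁ u₂ : Fin K → ZMod q) :
    ∑ y₁, ∑ y₂, (∏ n, noiseLaw q ε₁ (noiseWord c u₁ u₂ y₁ y₂ y₁ n)) *
      (noiseWeightLaw q N ε₂ (hammingNorm (noiseWord c u₁ u₂ y₁ y₂ y₂)) *
        hammingNorm (noiseWord c u₁ u₂ y₁ y₂ y₂)) = N * ε₂ := by
  rw [sum_prod_noiseLaw_mul_noiseWord c hq ε₁ u₁ u₂
    fun z => noiseWeightLaw q N ε₂ (hammingNorm z) * (hammingNorm z : ℝ)]
  simp only [← prod_noiseLaw]
  exact sum_prod_noiseLaw_mul_hammingNorm hq ε₂ N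

theorem sum_hammingDist {M : Type*} [AddCommMonoid M] (v : Fin K → ZMod q) (F : ℕ → M) :
    ∑ u, F (hammingDist u v) = ∑ u : Fin K → ZMod q, F (hammingNorm u) := by
  simp only [hammingDist_comm _ v, hammingDist_eq_hammingNorm, neg_add_eq_sub]
  exact Equiv.sum_comp (Equiv.subRight v) fun u => F (hammingNorm u)

/-- Converse with the source block `u₂` of the decoding terminal fixed. -/
theorem le_sum_noiseWord_hammingDist (hq : 2 ≤ q) {ε₁ ε₂ : ℝ}
    (hε₁ : 0 ≤ ε₁) (hε₁' : ε₁ ≤ ((q : ℝ) - 1) / q)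
    (hε₂ : 0 ≤ ε₂) (hε₂' : ε₂ ≤ ((q : ℝ) - 1) / q) (u₂ : Fin K → ZMod q) :
    (q : ℝ) ^ K * (N * ε₂ - (N - K : ℕ)) ≤ ∑ u₁, ∑ y₁, ∑ y₂,
      (∏ n, noiseLaw q ε₁ (noiseWord c u₁ u₂ y₁ y₂ y₁ n)) *
        (noiseWeightLaw q N ε₂ (hammingNorm (noiseWord c u₁ u₂ y₁ y₂ y₂)) *
          hammingDist u₁ (c.g₂ u₂ y₂)) := by
  obtain ⟨hw0, hw⟩ := noiseWeightLaw_nonneg_antitone hq hε₂ hε₂' N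
  set w := noiseWeightLaw q N ε₂ with hwdef
  -- The discrete primitive of `w`: its tangent slope at the noise weight is the probability of the
  -- noise word.
  set F : ℕ → ℝ := fun k => ∑ j ∈ Finset.range k, w j with hF
  have hFm : Monotone F := monotone_nat_of_le_succ fun k => by
    simp only [hF, Finset.sum_range_succ]; linarith [hw0 k]
  set P : (Fin K → ZMod q) → (Fin N → ZMod q) → (Fin N → ZMod q) → ℝ := fun u₁ y₁ y₂ =>
    ∏ n, noiseLaw q ε₁ (noiseWord c u₁ u₂ y₁ y₂ y₁ n) with hP
  have hP0 : ∀ u₁ y₁ y₂, 0 ≤ P u₁ y₁ y₂ := fun u₁ y₁ y₂ =>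
    Finset.prod_nonneg fun n _ => noiseLaw_nonneg hq hε₁ hε₁' _
  have hcard : ((Fintype.card (Fin K → ZMod q) : ℕ) : ℝ) = (q : ℝ) ^ K := by simp [ZMod.card]
  have hcardN : ((Fintype.card (Fin N → ZMod q) : ℕ) : ℝ) = (q : ℝ) ^ N := by simp [ZMod.card]
  -- the tangent inequality, summed over all outcomes
  have h1 : ∑ u₁, ∑ y₁, ∑ y₂, P u₁ y₁ y₂ * (F (hammingDist u₁ (c.g₂ u₂ y₂) + (N - K)) -
        F (hammingNorm (noiseWord c u₁ u₂ y₁ y₂ y₂))) ≤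
      ∑ u₁, ∑ y₁, ∑ y₂, (P u₁ y₁ y₂ * (w (hammingNorm (noiseWord c u₁ u₂ y₁ y₂ y₂)) *
          hammingDist u₁ (c.g₂ u₂ y₂)) +
        ((N - K : ℕ) * (P u₁ y₁ y₂ * w (hammingNorm (noiseWord c u₁ u₂ y₁ y₂ y₂))) -
        P u₁ y₁ y₂ * (w (hammingNorm (noiseWord c u₁ u₂ y₁ y₂ y₂)) *
          hammingNorm (noiseWord c u₁ u₂ y₁ y₂ y₂)))) := by
    refine Finset.sum_le_sum fun u₁ _ => Finset.sum_le_sum fun y₁ _ =>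
      Finset.sum_le_sum fun y₂ _ => ?_
    have h := mul_le_mul_of_nonneg_left (sum_range_sub_le_of_antitone hw
      (hammingNorm (noiseWord c u₁ u₂ y₁ y₂ y₂))
      (hammingDist u₁ (c.g₂ u₂ y₂) + (N - K))) (hP0 u₁ y₁ y₂)
    refine h.trans (le_of_eq ?_)
    push_cast
    ring
  -- The estimate ignores `y₁`, so `P` sums to one over `y₁` at fixed `y₂`; translating `u₁` by the
  -- estimate then removes the decoder.
  have h2 : ∑ u₁, ∑ y₁, ∑ y₂, P u₁ y₁ y₂ * F (hammingDist u₁ (c.g₂ u₂ y₂) + (N - K)) =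
      (q : ℝ) ^ N * ∑ u : Fin K → ZMod q, F (hammingNorm u + (N - K)) := by
    have : ∀ u₁, ∑ y₁, ∑ y₂, P u₁ y₁ y₂ * F (hammingDist u₁ (c.g₂ u₂ y₂) + (N - K)) =
        ∑ y₂, F (hammingDist u₁ (c.g₂ u₂ y₂) + (N - K)) := fun u₁ => by
      rw [Finset.sum_comm]
      refine Finset.sum_congr rfl fun y₂ _ => ?_
      rw [← Finset.sum_mul, sum_prod_noiseLaw_noiseWord c hq ε₁ u₁ u₂ y₂, one_mul]
    rw [Finset.sum_congr rfl fun u₁ _ => this u₁, Finset.sum_comm,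
      Finset.sum_congr rfl fun y₂ _ => sum_hammingDist (c.g₂ u₂ y₂) fun k => F (k + (N - K)),
      Finset.sum_const, nsmul_eq_mul, Finset.card_univ, hcardN]
  have h3 : ∑ u₁, ∑ y₁, ∑ y₂, P u₁ y₁ y₂ * F (hammingNorm (noiseWord c u₁ u₂ y₁ y₂ y₂)) =
      (q : ℝ) ^ K * ∑ z : Fin N → ZMod q, F (hammingNorm z) := by
    rw [Finset.sum_congr rfl fun u₁ _ => sum_prod_noiseLaw_mul_noiseWord c hq ε₁ u₁ u₂
      fun z => F (hammingNorm z), Finset.sum_const, nsmul_eq_mul, Finset.card_univ, hcard]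
  have h4 := card_pow_mul_sum_hammingNorm_compare (G := ZMod q) hFm K N
  rw [ZMod.card] at h4
  simp only [mul_sub, Finset.sum_sub_distrib, Finset.sum_add_distrib] at h1
  rw [h2, h3] at h1
  simp only [← Finset.mul_sum] at h1
  rw [Finset.sum_congr rfl fun u₁ _ => sum_prod_noiseLaw_mul_noiseWeightLaw c hq ε₁ ε₂ u₁ u₂,
    Finset.sum_congr rfl fun u₁ _ =>
      sum_prod_noiseLaw_mul_noiseWeightLaw_mul_hammingNorm c hq ε₁ ε₂ u₁ u₂,
    Finset.sum_const, Finset.sum_const, nsmul_eq_mul, nsmul_eq_mul, Finset.card_univ, hcard] at h1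
  linarith

/-- Converse at all source lengths and numbers of channel uses. -/
theorem le_expDistortion₁ (hq : 2 ≤ q) {ε₁ ε₂ : ℝ}
    (hε₁ : 0 ≤ ε₁) (hε₁' : ε₁ ≤ ((q : ℝ) - 1) / q)
    (hε₂ : 0 ≤ ε₂) (hε₂' : ε₂ ≤ ((q : ℝ) - 1) / q) {pS : ZMod q → ZMod q → ℝ}
    (hS : ∀ u v, pS u v = 1 / (q : ℝ) * (1 / (q : ℝ))) :
    (K : ℝ)⁻¹ * (N * ε₂ - (N - K : ℕ)) ≤
      expDistortion₁ pS (additiveTWC q ε₁ ε₂) hamming c := by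
  have hqK : (0 : ℝ) < (q : ℝ) ^ K := by
    have : (0 : ℝ) < q := by exact_mod_cast (by omega : 0 < q)
    positivity
  rw [expDistortion₁_eq c ε₁ ε₂ hS]
  refine mul_le_mul_of_nonneg_left ?_ (by positivity)
  have h := Finset.sum_le_sum fun u₂ (_ : u₂ ∈ Finset.univ) =>
    le_sum_noiseWord_hammingDist c hq hε₁ hε₁' hε₂ hε₂' u₂
  rw [Finset.sum_const, nsmul_eq_mul, Finset.card_univ, Fintype.card_fun, ZMod.card,
    Fintype.card_fin, Nat.cast_pow] at h
  refine le_trans (le_of_eq ?_) (mul_le_mul_of_nonneg_left h (by positivity))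
  field_simp

/-- Supplies the boundedness without which a real `limsup` need not dominate the converse bounds. -/
theorem expDistortion₁_le_one (hq : 2 ≤ q) {ε₁ ε₂ : ℝ}
    (hε₁ : 0 ≤ ε₁) (hε₁' : ε₁ ≤ ((q : ℝ) - 1) / q)
    (hε₂ : 0 ≤ ε₂) (hε₂' : ε₂ ≤ ((q : ℝ) - 1) / q) {pS : ZMod q → ZMod q → ℝ}
    (hS : ∀ u v, pS u v = 1 / (q : ℝ) * (1 / (q : ℝ))) :
    expDistortion₁ pS (additiveTWC q ε₁ ε₂) hamming c ≤ 1 := by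
  have hqK : (0 : ℝ) < (q : ℝ) ^ K := by
    have : (0 : ℝ) < q := by exact_mod_cast (by omega : 0 < q)
    positivity
  have hw0 := (noiseWeightLaw_nonneg_antitone hq hε₂ hε₂' N).1
  have h : ∀ u₂ u₁ : Fin K → ZMod q, ∑ y₁, ∑ y₂,
      (∏ n, noiseLaw q ε₁ (noiseWord c u₁ u₂ y₁ y₂ y₁ n)) *
        (noiseWeightLaw q N ε₂ (hammingNorm (noiseWord c u₁ u₂ y₁ y₂ y₂)) *
          hammingDist u₁ (c.g₂ u₂ y₂)) ≤ K := by
    intro u₂ u₁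
    have := sum_prod_noiseLaw_mul_noiseWeightLaw c hq ε₁ ε₂ u₁ u₂
    rw [← one_mul (K : ℝ), ← this]
    simp only [Finset.sum_mul]
    refine Finset.sum_le_sum fun y₁ _ => Finset.sum_le_sum fun y₂ _ => ?_
    rw [← mul_assoc]
    refine mul_le_mul_of_nonneg_left ?_ (mul_nonneg
      (Finset.prod_nonneg fun n _ => noiseLaw_nonneg hq hε₁ hε₁' _) (hw0 _))
    exact_mod_cast hammingDist_le_card_fintype.trans_eq (Fintype.card_fin K)
  have h' := Finset.sum_le_sum fun u₂ (_ : u₂ ∈ Finset.univ) =>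
    Finset.sum_le_sum fun u₁ (_ : u₁ ∈ Finset.univ) => h u₂ u₁
  simp only [Finset.sum_const, nsmul_eq_mul, Finset.card_univ, Fintype.card_fun, ZMod.card,
    Fintype.card_fin, Nat.cast_pow] at h'
  rw [expDistortion₁_eq c ε₁ ε₂ hS]
  calc _ ≤ (K : ℝ)⁻¹ * (((q : ℝ) ^ K)⁻¹ * ((q : ℝ) ^ K)⁻¹ *
        ((q : ℝ) ^ K * ((q : ℝ) ^ K * K))) := by gcongr
    _ = (K : ℝ)⁻¹ * K := by field_simp
    _ ≤ 1 := inv_mul_le_one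

/-- The error word of the decoder is exactly the noise word at terminal 2. -/
theorem expDistortion₁_uncoded (hq : 2 ≤ q) (ε₁ ε₂ : ℝ) {pS : ZMod q → ZMod q → ℝ}
    (hS : ∀ u v, pS u v = 1 / (q : ℝ) * (1 / (q : ℝ))) (hN : 0 < N) :
    expDistortion₁ pS (additiveTWC q ε₁ ε₂) hamming (uncoded q N) = ε₂ := by
  have hq0 : (q : ℝ) ≠ 0 := by exact_mod_cast (by omega : q ≠ 0)
  have hN0 : (N : ℝ) ≠ 0 := by exact_mod_cast hN.ne'
  have hd : ∀ u₁ u₂ y₁ y₂ : Fin N → ZMod q, hammingDist u₁ ((uncoded q N).g₂ u₂ y₂) =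
      hammingNorm (noiseWord (uncoded q N) u₁ u₂ y₁ y₂ y₂) := by
    intro u₁ u₂ y₁ y₂
    rw [hammingDist_eq_hammingNorm]
    congr 1
    funext n
    simp only [uncoded, scalarCode, noiseWord, Pi.add_apply, Pi.neg_apply, id]
    ring
  rw [expDistortion₁_eq _ ε₁ ε₂ hS]
  have h : ∀ u₂ u₁ : Fin N → ZMod q, ∑ y₁, ∑ y₂,
      (∏ n, noiseLaw q ε₁ (noiseWord (uncoded q N) u₁ u₂ y₁ y₂ y₁ n)) *
        (noiseWeightLaw q N ε₂ (hammingNorm (noiseWord (uncoded q N) u₁ u₂ y₁ y₂ y₂)) *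
          hammingDist u₁ ((uncoded q N).g₂ u₂ y₂)) = N * ε₂ := by
    intro u₂ u₁
    rw [← sum_prod_noiseLaw_mul_noiseWeightLaw_mul_hammingNorm (uncoded q N) hq ε₁ ε₂ u₁ u₂]
    refine Finset.sum_congr rfl fun y₁ _ => Finset.sum_congr rfl fun y₂ _ => ?_
    rw [hd u₁ u₂ y₁ y₂]
  simp only [h, Finset.sum_const, nsmul_eq_mul, Finset.card_univ, Fintype.card_fun, ZMod.card,
    Fintype.card_fin, Nat.cast_pow]
  field_simp

end Code

/-! ### Exchange of the terminals, rate-one limit and conclusion. -/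

/-- The code with the two terminals exchanged. -/
def TWCode.swap {U₁ U₂ X₁ X₂ Y₁ Y₂ : Type*} {K N : ℕ} (c : TWCode U₁ U₂ X₁ X₂ Y₁ Y₂ K N) :
    TWCode U₂ U₁ X₂ X₁ Y₂ Y₁ K N where
  f₁ := c.f₂
  f₂ := c.f₁
  g₁ := c.g₂
  g₂ := c.g₁

theorem expDistortion₂_eq_swap {q K N : ℕ} [NeZero q] (ε₁ ε₂ : ℝ) {pS : ZMod q → ZMod q → ℝ}
    (hS : ∀ u v, pS u v = 1 / (q : ℝ) * (1 / (q : ℝ)))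
    (c : TWCode (ZMod q) (ZMod q) (ZMod q) (ZMod q) (ZMod q) (ZMod q) K N) :
    expDistortion₂ pS (additiveTWC q ε₁ ε₂) hamming c =
      expDistortion₁ pS (additiveTWC q ε₂ ε₁) hamming c.swap := by
  rw [expDistortion₂, expDistortion₁, Finset.sum_comm]
  refine Finset.sum_congr rfl fun u₂ _ => Finset.sum_congr rfl fun u₁ _ => ?_
  rw [Finset.sum_comm]
  refine Finset.sum_congr rfl fun y₂ _ => Finset.sum_congr rfl fun y₁ _ => ?_
  congr 1
  simp only [jointProb, hS, additiveTWC, TWCode.swap]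
  congr 1
  refine Finset.prod_congr rfl fun n _ => ?_
  rw [mul_comm, add_comm]

/-- A bounded sequence above the finite-length converse bounds has limit superior at least `ε`
when the rate tends to one. -/
theorem le_limsup_of_rate_one {N : ℕ → ℕ} {ε : ℝ} {D : ℕ → ℝ}
    (hN : Tendsto (fun K : ℕ => (K : ℝ) / (N K : ℝ)) atTop (𝓝 1))
    (hD : ∀ K : ℕ, (K : ℝ)⁻¹ * (N K * ε - (N K - K : ℕ)) ≤ D K) (hD1 : ∀ K, D K ≤ 1) :
    ε ≤ limsup D atTop := by
  have hr : Tendsto (fun K : ℕ => (N K : ℝ) / (K : ℝ)) atTop (𝓝 1) := by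
    simpa using hN.inv₀ one_ne_zero
  -- The `max` is the normalized truncated difference `N K - K`, in a form visibly continuous in `N
  -- K / K`.
  have hlim : Tendsto (fun K : ℕ => (N K : ℝ) / K * ε - max ((N K : ℝ) / K - 1) 0) atTop (𝓝 ε) := by
    have := (hr.mul_const ε).sub ((hr.sub_const 1).max (tendsto_const_nhds (x := (0 : ℝ))))
    simpa using this
  have hle : ∀ᶠ K : ℕ in atTop, (N K : ℝ) / K * ε - max ((N K : ℝ) / K - 1) 0 ≤ D K := by
    filter_upwards [eventually_gt_atTop 0] with K hK
    have hK' : (0 : ℝ) < K := by exact_mod_cast hK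
    refine le_trans (le_of_eq ?_) (hD K)
    rcases le_total (N K) K with h | h
    · have : (N K : ℝ) / K ≤ 1 := by
        rw [div_le_one hK']; exact_mod_cast h
      rw [max_eq_right (by linarith), Nat.sub_eq_zero_of_le h]
      rw [Nat.cast_zero, sub_zero, sub_zero, div_eq_inv_mul, mul_assoc]
    · have : 1 ≤ (N K : ℝ) / K := by
        rw [one_le_div hK']; exact_mod_cast h
      rw [max_eq_left (by linarith), Nat.cast_sub h]
      field_simp
  rw [← hlim.limsup_eq]
  exact limsup_le_limsup hle hlim.isBoundedUnder_ge.isCoboundedUnder_le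
    (isBoundedUnder_of ⟨1, hD1⟩)

theorem mainTheorem6 (q : ℕ) [NeZero q] (hq : 2 ≤ q) (ε₁ ε₂ : ℝ)
    (hε₁ : 0 ≤ ε₁) (hε₁' : ε₁ ≤ ((q : ℝ) - 1) / q)
    (hε₂ : 0 ≤ ε₂) (hε₂' : ε₂ ≤ ((q : ℝ) - 1) / q)
    (pS : ZMod q → ZMod q → ℝ)
    -- independent uniform sources, or binary symmetric sources of correlation `1 - 2 * δ = 0`
    (hS : (∀ u v, pS u v = 1 / (q : ℝ) * (1 / (q : ℝ))) ∨
      (q = 2 ∧ ∃ δ : ℝ, 0 ≤ δ ∧ δ ≤ 1 / 2 ∧ 1 - 2 * δ = 0 ∧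
        ∀ u v, pS u v = 1 / 2 * (if u = v then 1 - δ else δ))) :
    -- converse: every pair that is achievable at rate 1
    (∀ D₁ D₂ : ℝ, Achievable pS (additiveTWC q ε₁ ε₂) hamming hamming 1 D₁ D₂ →
      ε₂ ≤ D₁ ∧ ε₁ ≤ D₂) ∧
    -- converse at each finite blocklength, for every code with `N = K`
    (∀ N : ℕ, 0 < N →
      ∀ c : TWCode (ZMod q) (ZMod q) (ZMod q) (ZMod q) (ZMod q) (ZMod q) N N,
        ε₂ ≤ expDistortion₁ pS (additiveTWC q ε₁ ε₂) hamming c ∧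
        ε₁ ≤ expDistortion₂ pS (additiveTWC q ε₁ ε₂) hamming c) ∧
    -- uncoded transmission attains both bounds exactly, at each blocklength
    (∀ N : ℕ, 0 < N →
      expDistortion₁ pS (additiveTWC q ε₁ ε₂) hamming (uncoded q N) = ε₂ ∧
      expDistortion₂ pS (additiveTWC q ε₁ ε₂) hamming (uncoded q N) = ε₁) ∧
    -- hence the pair of bounds is itself achievable at rate 1
    Achievable pS (additiveTWC q ε₁ ε₂) hamming hamming 1 ε₂ ε₁ := by
  have hS' : ∀ u v, pS u v = 1 / (q : ℝ) * (1 / (q : ℝ)) := by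
    rcases hS with hS | ⟨rfl, δ, -, -, hδ, hS⟩
    · exact hS
    · intro u v
      -- Zero correlation makes the binary pair independent and uniform, so both source models
      -- coincide.
      obtain rfl : δ = 1 / 2 := by linarith
      rw [hS]
      split_ifs <;> norm_num
  have hfin : ∀ N : ℕ, 0 < N → ∀ ε : ℝ, (N : ℝ)⁻¹ * (N * ε - (N - N : ℕ)) = ε := by
    intro N hN ε
    have : (N : ℝ) ≠ 0 := by exact_mod_cast hN.ne'
    simp [this]
  have hunc : ∀ N : ℕ, 0 < N →
      expDistortion₁ pS (additiveTWC q ε₁ ε₂) hamming (uncoded q N) = ε₂ ∧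
      expDistortion₂ pS (additiveTWC q ε₁ ε₂) hamming (uncoded q N) = ε₁ := fun N hN =>
    ⟨expDistortion₁_uncoded hq ε₁ ε₂ hS' hN, by
      rw [expDistortion₂_eq_swap ε₁ ε₂ hS']
      exact expDistortion₁_uncoded hq ε₂ ε₁ hS' hN⟩
  refine ⟨?_, ?_, hunc, ?_⟩
  · rintro D₁ D₂ ⟨N, c, -, hN, h1, h2⟩
    refine ⟨le_trans (le_limsup_of_rate_one hN
        (fun K => le_expDistortion₁ (c K) hq hε₁ hε₁' hε₂ hε₂' hS')
        fun K => expDistortion₁_le_one (c K) hq hε₁ hε₁' hε₂ hε₂' hS') h1,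
      le_trans ?_ h2⟩
    simp only [expDistortion₂_eq_swap ε₁ ε₂ hS']
    exact le_limsup_of_rate_one hN
      (fun K => le_expDistortion₁ (c K).swap hq hε₂ hε₂' hε₁ hε₁' hS')
      fun K => expDistortion₁_le_one (c K).swap hq hε₂ hε₂' hε₁ hε₁' hS'
  · intro N hN c
    refine ⟨?_, ?_⟩
    · simpa only [hfin N hN] using le_expDistortion₁ c hq hε₁ hε₁' hε₂ hε₂' hS'
    · rw [expDistortion₂_eq_swap ε₁ ε₂ hS']
      simpa only [hfin N hN] using le_expDistortion₁ c.swap hq hε₂ hε₂' hε₁ hε₁' hS'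
  · refine ⟨fun K => K, fun K => uncoded q K, fun K hK => hK, ?_, ?_, ?_⟩
    -- Only eventual equality holds: at `K = 0` the quotient is `0 / 0 = 0`.
    · refine tendsto_const_nhds.congr' ?_
      filter_upwards [eventually_gt_atTop 0] with K hK
      exact (div_self (by exact_mod_cast hK.ne' : (K : ℝ) ≠ 0)).symm
    · refine (Tendsto.limsup_eq (tendsto_const_nhds.congr' ?_)).le
      filter_upwards [eventually_gt_atTop 0] with K hK using (hunc K hK).1.symm
    · refine (Tendsto.limsup_eq (tendsto_const_nhds.congr' ?_)).le
      filter_upwards [eventually_gt_atTop 0] with K hK using (hunc K hK).2.symm
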